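/- Let $J_1,\dots,J_N:\mathbb{R}^M\to\mathbb{R}$ be twice differentiable. Suppose that each $J_k$ is strongly convex ($\nabla^2J_k(w)\ge\nu_kI$ for all $w$, for some $\nu_k>0$), that all the $J_k$ have the same global minimizer $w^o$, and that $J^{\rm glob}=\sum_kJ_k$ satisfies $\nu_dI\le\nabla^2J^{\rm glob}(w)\le\delta_dI$ for all $w$, for some $0<\nu_d\le\delta_d$. Let $\beta_k^2,\sigma_{s,k}^2\ge0$ $(k=1,\dots,N)$ be constants. Consider $N$ agents that run asynchronous ATC diffusion: for $i\ge0$ and $k=1,\dots,N$, $$\boldsymbol\psi_{k,i}=\boldsymbol w_{k,i-1}-\boldsymbol\mu_k(i)\,\widehat{\nabla J}_k(\boldsymbol w_{k,i-1};\boldsymbol x_{k,i}),\qquad \boldsymbol w_{k,i}=\sum_{\ell=1}^N\boldsymbol a_{\ell k}(i)\,\boldsymbol\psi_{\ell,i},$$ where $\boldsymbol x_{k,i}$ is the (random) data of agent $k$ at time $i$, $\widehat{\nabla J}_k$ is a jointly measurable function of the point and the data, and the initial iterates $\boldsymbol w_{k,-1}$ are random with $\mathbb{E}\|\boldsymbol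 w_{k,-1}\|^2<\infty$. Assume: 1. The step-sizes $\boldsymbol\mu_k(i)$ are square-integrable random variables whose mean $\bar\mu_k>0$ and variance $\sigma_{\mu,k}^2$ do not depend on $i$. The random matrices $\boldsymbol A_i=[\boldsymbol a_{\ell k}(i)]$ are left-stochastic: $\boldsymbol a_{\ell k}(i)\ge0$ and $\sum_\ell\boldsymbol a_{\ell k}(i)=1$ almost surely. 2. The step-size vectors $(\boldsymbol\mu_k(i))_{k}$, $i\ge0$, the matrices $\boldsymbol A_i$, $i\ge0$, and the collection of all the other random variables of the algorithm (initial iterates and data of all times and agents) are mutually independent. (Step-sizes of different agents at the same time may be dependent, and so may different entries of one matrix $\boldsymbol A_i$.) 3. Let $\mathcal F_{i-1}$ be the $\sigma$-algebra generated by all iterates $\boldsymbol w_{\ell,j}$, $1\le\ell\le N$, $-1\le j\le i-1$, and let $\boldsymbol s_{k,i}=\widehat{\nabla J}_k(\boldsymbol w_{k,i-1};\boldsymbol x_{k,i})-\nabla J_k(\boldsymbol w_{k,i-1})$ be the gradient noise. It is square-integrable, and almost surely $\mathbb{E}[\boldsymbol s_{k,i}\mid\mathcal F_{i-1}]=0$,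 $\mathbb{E}[\boldsymbol s_{k,i}\boldsymbol s_{\ell,i}^{\mathsf T}\mid\mathcal F_{i-1}]=0$ for $k\ne\ell$, and $\mathbb{E}[\|\boldsymbol s_{k,i}\|^2\mid\mathcal F_{i-1}]\le\beta_k^2\|\widetilde{\boldsymbol w}_{k,i-1}\|^2+\sigma_{s,k}^2$, where $\widetilde{\boldsymbol w}_{k,i}=w^o-\boldsymbol w_{k,i}$. Let $\mu_{x,\max}=\max_{1\le k\le N}\left(\bar\mu_k+\sigma_{\mu,k}^2/\bar\mu_k\right)$. Then there are $\mu_o>0$ and $b\ge0$, which depend only on the costs $J_k$ (with $w^o$) and on the constants $\beta_k^2,\sigma_{s,k}^2$, such that whenever $\mu_{x,\max}<\mu_o$, $$\limsup_{i\to\infty}\mathbb{E}\|\widetilde{\boldsymbol w}_{k,i}\|^2\le b\,\mu_{x,\max}\qquad\text{for every agent }k;$$ that is, $\limsup_{i\to\infty}\mathbb{E}\|\widetilde{\boldsymbol w}_{k,i}\|^2=O(\mu_{x,\max})$. -/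

import Mathlib

open MeasureTheory ProbabilityTheory Filter

noncomputable section

/-- The Hessian of `J : ℝ^M → ℝ` at `w`: the derivative of the gradient map. -/
def hessian {M : ℕ} (J : EuclideanSpace ℝ (Fin M) → ℝ) (w : EuclideanSpace ℝ (Fin M)) :
    EuclideanSpace ℝ (Fin M) →L[ℝ] EuclideanSpace ℝ (Fin M) :=
  fderiv ℝ (gradient J) w

/-- `J` is twice (Fréchet) differentiable on `ℝ^M`. -/
def TwiceDifferentiable {M : ℕ} (J : EuclideanSpace ℝ (Fin M) → ℝ) : Prop :=
  Differentiable ℝ J ∧ Differentiable ℝ (gradient J)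

/-- `∇² J(w) ≥ ν I` for all `w`. -/
def HessianBoundedBelow {M : ℕ} (ν : ℝ) (J : EuclideanSpace ℝ (Fin M) → ℝ) : Prop :=
  ∀ w v : EuclideanSpace ℝ (Fin M), ν * ‖v‖ ^ 2 ≤ inner ℝ (hessian J w v) v

/-- `∇² J(w) ≤ δ I` for all `w`. -/
def HessianBoundedAbove {M : ℕ} (δ : ℝ) (J : EuclideanSpace ℝ (Fin M) → ℝ) : Prop :=
  ∀ w v : EuclideanSpace ℝ (Fin M), inner ℝ (hessian J w v) v ≤ δ * ‖v‖ ^ 2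

/-- Conditions on the costs: each `J k` is twice differentiable and strongly convex with
global minimizer `wo`, and the aggregate cost `∑ k, J k` satisfies `0 < ν I ≤ ∇² ≤ δ I`. -/
structure CostConditions {N M : ℕ} (J : Fin N → EuclideanSpace ℝ (Fin M) → ℝ)
    (wo : EuclideanSpace ℝ (Fin M)) : Prop where
  twiceDifferentiable : ∀ k, TwiceDifferentiable (J k)
  stronglyConvex : ∀ k, ∃ ν : ℝ, 0 < ν ∧ HessianBoundedBelow ν (J k)
  minimizer : ∀ k w, J k wo ≤ J k w
  aggregate : ∃ ν δ : ℝ, 0 < ν ∧ ν ≤ δ ∧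
    HessianBoundedBelow ν (fun w => ∑ k, J k w) ∧
    HessianBoundedAbove δ (fun w => ∑ k, J k w)

/-- The random variables that drive asynchronous ATC diffusion over `N` agents in `ℝ^M`.
The agents' approximate gradients are functions of streaming data: at time `i`, agent `k` uses
`gradHat k w (data i ω k)` in place of the gradient of its cost at `w`. -/
structure AsyncDiffusion (N M : ℕ) (Ω X : Type*) where
  /-- the initial iterates (those at time `-1`) -/
  init : Ω → Fin N → EuclideanSpace ℝ (Fin M)
  /-- `step i ω k` is the random step-size of agent `k` at time `i` -/
  step : ℕ → Ω → Fin N → ℝ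
  /-- `comb i ω` is the random combination matrix at time `i`; its entry `(ℓ, k)` is the weight
  that agent `k` gives to agent `ℓ` -/
  comb : ℕ → Ω → Matrix (Fin N) (Fin N) ℝ
  /-- `data i ω k` is the data sample of agent `k` at time `i` -/
  data : ℕ → Ω → Fin N → X
  /-- the approximate gradient of agent `k`, as a function of the point and the data sample -/
  gradHat : Fin N → EuclideanSpace ℝ (Fin M) → X → EuclideanSpace ℝ (Fin M)

namespace AsyncDiffusion

variable {N M : ℕ} {Ω X : Type*}

/-- The adaptation step at time `i`, started from the iterates `w`. -/
def adapt (net : AsyncDiffusion N M Ω X) (i : ℕ) (ω : Ω)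
    (w : Fin N → EuclideanSpace ℝ (Fin M)) (k : Fin N) : EuclideanSpace ℝ (Fin M) :=
  w k - net.step i ω k • net.gradHat k (w k) (net.data i ω k)

/-- The iterates of ATC diffusion. `net.iter i ω k` is the iterate of agent `k` before the update
of time `i` (after the update of time `i - 1`), so that index `0` is the initial condition.
The random neighbourhood of agent `k` at time `i` is the set of all `ℓ` whose weight is nonzero,
so the sum over the neighbourhood is the sum over all agents. -/
def iter (net : AsyncDiffusion N M Ω X) : ℕ → Ω → Fin N → EuclideanSpace ℝ (Fin M)
  | 0, ω => net.init ω
  | i + 1, ω => fun k => ∑ ℓ, net.comb i ω ℓ k • net.adapt i ω (net.iter i ω) ℓ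

/-- The σ-algebra generated by the iterates of all agents that are available when the update of
time `i` starts. -/
@[reducible] def past (net : AsyncDiffusion N M Ω X) (i : ℕ) : MeasurableSpace Ω :=
  ⨆ j ≤ i, MeasurableSpace.comap (net.iter j) inferInstance

/-- The gradient noise of agent `k` at time `i`, evaluated at its current iterate:
approximate gradient minus true gradient. -/
def noise (net : AsyncDiffusion N M Ω X) (J : Fin N → EuclideanSpace ℝ (Fin M) → ℝ)
    (i : ℕ) (k : Fin N) (ω : Ω) : EuclideanSpace ℝ (Fin M) :=
  net.gradHat k (net.iter i ω k) (net.data i ω k) - gradient (J k) (net.iter i ω k)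

variable [MeasurableSpace Ω]

/-- Mean of the step-size of agent `k` (the same at all times, see `Conditions`). -/
def stepMean (net : AsyncDiffusion N M Ω X) (P : Measure Ω) (k : Fin N) : ℝ :=
  ∫ ω, net.step 0 ω k ∂P

/-- Variance of the step-size of agent `k` (the same at all times, see `Conditions`). -/
def stepVar (net : AsyncDiffusion N M Ω X) (P : Measure Ω) (k : Fin N) : ℝ :=
  variance (fun ω => net.step 0 ω k) P

/-- `μ_{x,max}`, the maximum over the agents of the mean plus the variance divided by the mean
of their step-sizes. -/
def muxMax (net : AsyncDiffusion N M Ω X) (P : Measure Ω) : ℝ :=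
  ⨆ k, (net.stepMean P k + net.stepVar P k / net.stepMean P k)

/-- The mean-square error of agent `k` with respect to `wo`. -/
def meanSquareError (net : AsyncDiffusion N M Ω X) (P : Measure Ω)
    (wo : EuclideanSpace ℝ (Fin M)) (k : Fin N) (i : ℕ) : ENNReal :=
  ∫⁻ ω, ‖wo - net.iter i ω k‖ₑ ^ 2 ∂P

/-- The asynchronous network model. The step-size vectors of different times, the combination
matrices of different times, and the pair (initial iterates, data of all times and agents) are
mutually independent; step-sizes of different agents at one time, and different entries of one
combination matrix, may depend on each other. -/
structure Conditions [MeasurableSpace X] (net : AsyncDiffusion N M Ω X) (P : Measure Ω) : Prop where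
  measurable_init : Measurable net.init
  measurable_step : ∀ i, Measurable (net.step i)
  measurable_comb : ∀ i ℓ k, Measurable fun ω => net.comb i ω ℓ k
  measurable_data : ∀ i, Measurable (net.data i)
  measurable_gradHat : ∀ k, Measurable (Function.uncurry (net.gradHat k))
  /-- the initial iterates have finite second moments -/
  memLp_init : ∀ k, MemLp (fun ω => net.init ω k) 2 P
  /-- the step-sizes have finite second moments -/
  memLp_step : ∀ i k, MemLp (fun ω => net.step i ω k) 2 P
  mean_step : ∀ i k, ∫ ω, net.step i ω k ∂P = net.stepMean P k
  var_step : ∀ i k, variance (fun ω => net.step i ω k) P = net.stepVar P k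
  stepMean_pos : ∀ k, 0 < net.stepMean P k
  /-- the combination matrices are left-stochastic -/
  leftStochastic : ∀ i, ∀ᵐ ω ∂P,
    (∀ ℓ k, 0 ≤ net.comb i ω ℓ k) ∧ ∀ k, ∑ ℓ, net.comb i ω ℓ k = 1
  indep_step : iIndepFun net.step P
  indep_comb : iIndepFun (fun i ω ℓ k => net.comb i ω ℓ k) P
  indep_step_comb : IndepFun (fun ω i => net.step i ω) (fun ω i ℓ k => net.comb i ω ℓ k) P
  indep_other : IndepFun
    (fun ω => ((fun i => net.step i ω), (fun i ℓ k => net.comb i ω ℓ k)))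
    (fun ω => (net.init ω, fun i => net.data i ω)) P

/-- Conditions on the gradient noise: conditionally on the past iterates it has zero mean, is
uncorrelated across the agents, and has second moment at most
`β k ^ 2 * ‖wo - current iterate‖ ^ 2 + σs k ^ 2`. -/
structure GradientNoiseConditions (net : AsyncDiffusion N M Ω X) (P : Measure Ω)
    (J : Fin N → EuclideanSpace ℝ (Fin M) → ℝ) (wo : EuclideanSpace ℝ (Fin M))
    (β σs : Fin N → ℝ) : Prop where
  /-- the conditional first and second moments below are those of square-integrable variables -/
  memLp : ∀ i k, MemLp (net.noise J i k) 2 P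
  unbiased : ∀ i k, P[net.noise J i k | net.past i] =ᵐ[P] 0
  uncorrelated : ∀ i k ℓ, k ≠ ℓ → ∀ p q : Fin M,
    P[fun ω => net.noise J i k ω p * net.noise J i ℓ ω q | net.past i] =ᵐ[P] 0
  boundedVariance : ∀ i k,
    P[fun ω => ‖net.noise J i k ω‖ ^ 2 | net.past i] ≤ᵐ[P]
      fun ω => β k ^ 2 * ‖wo - net.iter i ω k‖ ^ 2 + σs k ^ 2

end AsyncDiffusion

end

/-!
Because all costs share the minimizer `wo`, the recursion needs no bias term. Each local gradient
vanishes at `wo`, is strongly monotone there, and, since the Hessian of each convex cost is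
dominated by that of the aggregate, grows at most linearly. A random step-size that is independent
of the current iterate and data therefore contracts the mean-square error of agent `k` by the
factor `1 - ν * stepMean k`, at the price of an extra `stepMean k * muxMax * σs k ^ 2`. The second
moment of the step-size equals its mean times `mean + variance / mean`, which is why `muxMax` is
the right measure of size. The fixed point `σs k ^ 2 / ν * muxMax` of this affine map does not
depend on the agent's own step-size; combining the errors with independent convex weights does not,
by Jensen, exceed their maximum, so the common bound `(∑ k, σs k ^ 2) / ν * muxMax` survives the
combination step and is approached geometrically.
-/

section FirstOrder

variable {E : Type*} [NormedAddCommGroup E] [InnerProductSpace ℝ E]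

theorem exists_inner_sub_eq_inner_fderiv {G : E → E} (hG : Differentiable ℝ G) (x y : E) :
    ∃ z, inner ℝ (G y - G x) (y - x) = inner ℝ (fderiv ℝ G z (y - x)) (y - x) := by
  have hderiv : ∀ z ∈ Set.univ, HasFDerivWithinAt (fun z => inner ℝ (y - x) (G z))
      ((innerSL ℝ (y - x)).comp (fderiv ℝ G z)) Set.univ z := fun z _ =>
    ((innerSL ℝ (y - x)).hasFDerivAt.comp z (hG z).hasFDerivAt).hasFDerivWithinAt
  obtain ⟨z, -, hz⟩ := domain_mvt hderiv convex_univ (Set.mem_univ x) (Set.mem_univ y)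
  refine ⟨z, ?_⟩
  rw [real_inner_comm, inner_sub_right, hz, real_inner_comm]
  rfl

variable [CompleteSpace E] {f : E → ℝ} {δ : ℝ} {x₀ : E}

theorem gradient_eq_zero_of_forall_le (hmin : ∀ x, f x₀ ≤ f x) : gradient f x₀ = 0 := by
  have hloc : IsLocalMin f x₀ := Eventually.of_forall hmin
  rw [gradient, hloc.fderiv_eq_zero, map_zero]

theorem measurable_gradient [MeasurableSpace E] [BorelSpace E] (f : E → ℝ) :
    Measurable (gradient f) :=
  (InnerProductSpace.toDual ℝ E).symm.continuous.measurable.comp (measurable_fderiv ℝ f)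

theorem gradient_fun_sum {ι : Type*} [Fintype ι] {f : ι → E → ℝ}
    (hf : ∀ k, Differentiable ℝ (f k)) :
    gradient (fun x => ∑ k, f k x) = fun x => ∑ k, gradient (f k) x := by
  funext x
  simp only [gradient]
  rw [fderiv_fun_sum fun k _ => hf k x, map_sum]

theorem le_add_inner_gradient_add_sq (hf : Differentiable ℝ f)
    (hδ : ∀ x y, inner ℝ (gradient f y - gradient f x) (y - x) ≤ δ * ‖y - x‖ ^ 2) (x v : E) :
    f (x + v) ≤ f x + inner ℝ (gradient f x) v + δ / 2 * ‖v‖ ^ 2 := by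
  have hline : ∀ t : ℝ, HasDerivAt (fun t : ℝ => f (x + t • v))
      (inner ℝ (gradient f (x + t • v)) v) t := fun t => by
    have hpath : HasDerivAt (fun t : ℝ => x + t • v) v t := by
      simpa only [one_smul] using ((hasDerivAt_id' t).smul_const v).const_add x
    exact (hf (x + t • v)).hasGradientAt.hasFDerivAt.comp_hasDerivAt t hpath
  have hquad : ∀ t : ℝ, HasDerivAt
      (fun t : ℝ => f x + t * inner ℝ (gradient f x) v + δ / 2 * (t ^ 2 * ‖v‖ ^ 2))
      (inner ℝ (gradient f x) v + δ * (t * ‖v‖ ^ 2)) t := fun t => by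
    refine ((((hasDerivAt_id' t).mul_const (inner ℝ (gradient f x) v)).const_add (f x)).add
      (((hasDerivAt_pow 2 t).mul_const (‖v‖ ^ 2)).const_mul (δ / 2))).congr_deriv ?_
    simp only [Nat.cast_ofNat, Nat.add_one_sub_one, pow_one, one_mul]
    ring
  have hslope : ∀ t : ℝ, 0 ≤ t → inner ℝ (gradient f (x + t • v)) v ≤
      inner ℝ (gradient f x) v + δ * (t * ‖v‖ ^ 2) := fun t ht => by
    rcases ht.eq_or_lt with rfl | ht
    · simp
    have h := hδ x (x + t • v)
    rw [add_sub_cancel_left, inner_smul_right, norm_smul, mul_pow, Real.norm_eq_abs, sq_abs,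
      inner_sub_left] at h
    refine le_of_mul_le_mul_left ?_ ht
    linarith
  have h := image_le_of_deriv_right_le_deriv_boundary (a := 0) (b := 1)
    (fun t _ => (hline t).continuousAt.continuousWithinAt) (fun t _ => (hline t).hasDerivWithinAt)
    (by simp) (fun t _ => (hquad t).continuousAt.continuousWithinAt)
    (fun t _ => (hquad t).hasDerivWithinAt) (fun t ht => hslope t ht.1)
    (Set.right_mem_Icc.2 zero_le_one)
  simpa only [one_smul, one_mul, one_pow] using h

theorem norm_gradient_le_of_forall_le (hf : Differentiable ℝ f) (hδ0 : 0 < δ)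
    (hδ : ∀ x y, inner ℝ (gradient f y - gradient f x) (y - x) ≤ δ * ‖y - x‖ ^ 2)
    (hmin : ∀ x, f x₀ ≤ f x) (x : E) : ‖gradient f x‖ ≤ δ * ‖x₀ - x‖ := by
  have hupper : f x ≤ f x₀ + δ / 2 * ‖x₀ - x‖ ^ 2 := by
    simpa only [add_sub_cancel, gradient_eq_zero_of_forall_le hmin, inner_zero_left, add_zero,
      norm_sub_rev] using le_add_inner_gradient_add_sq hf hδ x₀ (x - x₀)
  have hlower : f x₀ ≤ f x - (2 * δ)⁻¹ * ‖gradient f x‖ ^ 2 := by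
    -- one gradient descent step of length `1 / δ`
    have hstep := le_add_inner_gradient_add_sq hf hδ x (-δ⁻¹ • gradient f x)
    rw [inner_smul_right, real_inner_self_eq_norm_sq, norm_smul, mul_pow, Real.norm_eq_abs,
      sq_abs] at hstep
    refine (hmin _).trans (hstep.trans_eq ?_)
    field_simp
    ring
  have hgap : (2 * δ)⁻¹ * ‖gradient f x‖ ^ 2 ≤ δ / 2 * ‖x₀ - x‖ ^ 2 := by linarith
  rw [inv_mul_le_iff₀ (by positivity)] at hgap
  refine (sq_le_sq₀ (norm_nonneg _) (by positivity)).1 ?_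
  linarith

end FirstOrder

section Costs

variable {N M : ℕ} {J : Fin N → EuclideanSpace ℝ (Fin M) → ℝ} {wo : EuclideanSpace ℝ (Fin M)}

theorem HessianBoundedBelow.mul_sq_le_inner_gradient_sub {f : EuclideanSpace ℝ (Fin M) → ℝ}
    {ν : ℝ} (hν : HessianBoundedBelow ν f) (hf : Differentiable ℝ (gradient f))
    (x y : EuclideanSpace ℝ (Fin M)) :
    ν * ‖y - x‖ ^ 2 ≤ inner ℝ (gradient f y - gradient f x) (y - x) := by
  obtain ⟨z, hz⟩ := exists_inner_sub_eq_inner_fderiv hf x y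
  exact hz ▸ hν z (y - x)

theorem HessianBoundedAbove.inner_gradient_sub_le {f : EuclideanSpace ℝ (Fin M) → ℝ}
    {δ : ℝ} (hδ : HessianBoundedAbove δ f) (hf : Differentiable ℝ (gradient f))
    (x y : EuclideanSpace ℝ (Fin M)) :
    inner ℝ (gradient f y - gradient f x) (y - x) ≤ δ * ‖y - x‖ ^ 2 := by
  obtain ⟨z, hz⟩ := exists_inner_sub_eq_inner_fderiv hf x y
  exact hz ▸ hδ z (y - x)

theorem HessianBoundedAbove.of_sum {δ : ℝ} (hδ : HessianBoundedAbove δ fun w => ∑ k, J k w)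
    (hJ : ∀ k, TwiceDifferentiable (J k)) (hconvex : ∀ k, HessianBoundedBelow 0 (J k))
    (k : Fin N) : HessianBoundedAbove δ (J k) := fun w v => by
  have hsum : inner ℝ (hessian (fun w => ∑ k, J k w) w v) v =
      ∑ k, inner ℝ (hessian (J k) w v) v := by
    rw [hessian, gradient_fun_sum fun k => (hJ k).1, fderiv_fun_sum fun k _ => (hJ k).2 w,
      sum_apply, sum_inner]
    rfl
  have hnonneg : ∀ j, 0 ≤ inner ℝ (hessian (J j) w v) v := fun j => by
    simpa only [zero_mul] using hconvex j w v
  calc inner ℝ (hessian (J k) w v) v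
      ≤ ∑ j, inner ℝ (hessian (J j) w v) v :=
        Finset.single_le_sum (fun j _ => hnonneg j) (Finset.mem_univ k)
    _ ≤ δ * ‖v‖ ^ 2 := hsum ▸ hδ w v

/-- First-order conditions on a family of costs around a common minimizer `wo`: the restricted
secant inequality with constant `ν` and a gradient that grows at most linearly, with slope `L`.
They are all that the error recursion sees of the costs. Differentiability rules out points where
`gradient` takes the junk value `0`. -/
structure FirstOrderCostConditions (J : Fin N → EuclideanSpace ℝ (Fin M) → ℝ)
    (wo : EuclideanSpace ℝ (Fin M)) (ν L : ℝ) : Prop where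
  differentiable : ∀ k, Differentiable ℝ (J k)
  pos : 0 < ν
  secant : ∀ k w, ν * ‖wo - w‖ ^ 2 ≤ -inner ℝ (wo - w) (gradient (J k) w)
  growth : ∀ k w, ‖gradient (J k) w‖ ≤ L * ‖wo - w‖

theorem CostConditions.exists_hessianBoundedBelow (hJ : CostConditions J wo) :
    ∃ ν : ℝ, 0 < ν ∧ ∀ k, HessianBoundedBelow ν (J k) := by
  choose ν hν0 hν using hJ.stronglyConvex
  rcases isEmpty_or_nonempty (Fin N) with hN | hN
  · exact ⟨1, one_pos, fun k => hN.elim k⟩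
  · obtain ⟨k₀, hk₀⟩ := Finite.exists_min ν
    exact ⟨ν k₀, hν0 k₀, fun k w v =>
      (mul_le_mul_of_nonneg_right (hk₀ k) (sq_nonneg ‖v‖)).trans (hν k w v)⟩

theorem CostConditions.exists_firstOrderCostConditions (hJ : CostConditions J wo) :
    ∃ ν L : ℝ, FirstOrderCostConditions J wo ν L := by
  obtain ⟨ν, hν0, hν⟩ := hJ.exists_hessianBoundedBelow
  obtain ⟨νd, δ, hνd, hνδ, -, hδ⟩ := hJ.aggregate
  have hgrad k := (hJ.twiceDifferentiable k).2
  have hconvex k : HessianBoundedBelow 0 (J k) := fun w v =>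
    (mul_le_mul_of_nonneg_right hν0.le (sq_nonneg ‖v‖)).trans (hν k w v)
  have habove := hδ.of_sum hJ.twiceDifferentiable hconvex
  refine ⟨ν, δ, fun k => (hJ.twiceDifferentiable k).1, hν0, fun k w => ?_, fun k w => ?_⟩
  · have hmono := (hν k).mul_sq_le_inner_gradient_sub (hgrad k) w wo
    rwa [gradient_eq_zero_of_forall_le (hJ.minimizer k), zero_sub, inner_neg_left,
      real_inner_comm] at hmono
  · exact norm_gradient_le_of_forall_le (hJ.twiceDifferentiable k).1 (hνd.trans_le hνδ)
      ((habove k).inner_gradient_sub_le (hgrad k)) (hJ.minimizer k) w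

end Costs

section Independence

variable {Ω α β γ δ : Type*} [MeasurableSpace Ω] [MeasurableSpace α] [MeasurableSpace β]
  [MeasurableSpace γ] [MeasurableSpace δ] {P : Measure Ω} [IsProbabilityMeasure P]

theorem indepFun_prodMk_right_of_prodMk_left {X : Ω → α} {Y : Ω → β} {Z : Ω → γ}
    (hX : Measurable X) (hY : Measurable Y) (hZ : Measurable Z)
    (hXY : IndepFun X Y P) (hXYZ : IndepFun (fun ω => (X ω, Y ω)) Z P) :
    IndepFun X (fun ω => (Y ω, Z ω)) P := by
  have hYZ : IndepFun Y Z P := hXYZ.comp measurable_snd measurable_id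
  rw [indepFun_iff_map_prod_eq_prod_map_map (by fun_prop) (by fun_prop)] at hXY hXYZ hYZ ⊢
  have := Measure.isProbabilityMeasure_map (μ := P) hX.aemeasurable
  have := Measure.isProbabilityMeasure_map (μ := P) hY.aemeasurable
  have := Measure.isProbabilityMeasure_map (μ := P) hZ.aemeasurable
  rw [hYZ, ← Measure.prodAssoc_prod, ← hXY, ← hXYZ, Measure.map_map (by fun_prop) (by fun_prop)]
  rfl

-- `hW` says, through σ-algebras, that `W` is a function of `(X j)_{j ∈ S}`, `Y` and `Z`.
theorem indepFun_of_forall_measurable {ι : Type*} {X : ι → Ω → α} {Y : Ω → β} {Z : Ω → γ}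
    {W : Ω → δ} {S : Finset ι} {i : ι} (hi : i ∉ S)
    (hX : ∀ i, Measurable (X i)) (hY : Measurable Y) (hZ : Measurable Z)
    (hXi : iIndepFun X P) (hXY : IndepFun (fun ω i => X i ω) Y P)
    (hXYZ : IndepFun (fun ω => ((fun i => X i ω), Y ω)) Z P)
    (hW : ∀ m : MeasurableSpace Ω, (∀ j ∈ S, Measurable[m] (X j)) → Measurable[m] Y →
      Measurable[m] Z → Measurable[m] W) :
    IndepFun (X i) W P := by
  have hS : IndepFun (X i) (fun ω (j : S) => X j ω) P :=
    (hXi.indepFun_finset {i} S (Finset.disjoint_singleton_left.2 hi) hX).comp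
      (φ := fun f : ({i} : Finset ι) → α => f ⟨i, Finset.mem_singleton_self i⟩)
      (by fun_prop) measurable_id
  have hSY : IndepFun (X i) (fun ω => (fun j : S => X j ω, Y ω)) P :=
    indepFun_prodMk_right_of_prodMk_left (hX i) (by fun_prop) hY hS
      (hXY.comp (φ := fun f => (f i, fun j : S => f j)) (by fun_prop) measurable_id)
  have hSYZ : IndepFun (X i) (fun ω => ((fun j : S => X j ω, Y ω), Z ω)) P :=
    indepFun_prodMk_right_of_prodMk_left (hX i) (by fun_prop) hZ hSY
      (hXYZ.comp (φ := fun f => (f.1 i, (fun j : S => f.1 j, f.2))) (by fun_prop) measurable_id)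
  refine indep_of_indep_of_le_right hSYZ (Measurable.comap_le ?_)
  let T := fun ω => ((fun j : S => X j ω, Y ω), Z ω)
  have htriple : Measurable[MeasurableSpace.comap T inferInstance] T := comap_measurable T
  exact hW _ (fun j hj => (measurable_pi_apply (⟨j, hj⟩ : S)).comp htriple.fst.fst)
    htriple.fst.snd htriple.snd

end Independence

section SecondMoments

variable {Ω E : Type*} {m mΩ : MeasurableSpace Ω} {P : Measure Ω}
  [NormedAddCommGroup E] {f g : Ω → E}

theorem integrable_norm_sq (hf : MemLp f 2 P) : Integrable (fun ω => ‖f ω‖ ^ 2) P :=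
  (memLp_two_iff_integrable_sq_norm hf.1).1 hf

variable [InnerProductSpace ℝ E]

theorem integrable_inner (hf : MemLp f 2 P) (hg : MemLp g 2 P) :
    Integrable (fun ω => inner ℝ (f ω) (g ω)) P :=
  memLp_one_iff_integrable.1 ((innerSL ℝ).memLp_of_bilin 1 hf hg)

theorem integral_norm_add_sq (hf : MemLp f 2 P) (hg : MemLp g 2 P) :
    ∫ ω, ‖f ω + g ω‖ ^ 2 ∂P =
      ∫ ω, ‖f ω‖ ^ 2 ∂P + 2 * ∫ ω, inner ℝ (f ω) (g ω) ∂P + ∫ ω, ‖g ω‖ ^ 2 ∂P := by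
  have hinner := (integrable_inner hf hg).const_mul 2
  have hsum : Integrable (fun ω => ‖f ω‖ ^ 2 + 2 * inner ℝ (f ω) (g ω)) P :=
    (integrable_norm_sq hf).add hinner
  simp only [norm_add_sq_real]
  rw [integral_add hsum (integrable_norm_sq hg),
    integral_add (integrable_norm_sq hf) hinner, integral_const_mul]

theorem integral_inner_eq_zero_of_condExp_eq_zero [IsFiniteMeasure P] [CompleteSpace E]
    (hm : m ≤ mΩ) (hfm : StronglyMeasurable[m] f) (hf : MemLp f 2 P) (hg : MemLp g 2 P)
    (hg0 : P[g | m] =ᵐ[P] 0) : ∫ ω, inner ℝ (f ω) (g ω) ∂P = 0 := by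
  have hpull := condExp_bilin_of_stronglyMeasurable_left (innerSL ℝ) hfm
    (integrable_inner hf hg) (hg.integrable one_le_two)
  calc ∫ ω, inner ℝ (f ω) (g ω) ∂P
      = ∫ ω, (P[fun ω => innerSL ℝ (f ω) (g ω) | m]) ω ∂P := (integral_condExp hm).symm
    _ = ∫ _, (0 : ℝ) ∂P := by
        refine integral_congr_ae ?_
        filter_upwards [hpull, hg0] with ω hω hω0
        rw [hω, hω0, Pi.zero_apply, map_zero]
    _ = 0 := integral_zero _ _

variable [MeasurableSpace E] [BorelSpace E] {c : Ω → ℝ}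

theorem memLp_smul_of_indepFun (hc : MemLp c 2 P) (hf : MemLp f 2 P) (hind : IndepFun c f P) :
    MemLp (fun ω => c ω • f ω) 2 P := by
  have hsq : IndepFun (fun ω => c ω ^ 2) (fun ω => ‖f ω‖ ^ 2) P :=
    hind.comp (φ := fun x => x ^ 2) (ψ := fun x => ‖x‖ ^ 2) (by fun_prop) (by fun_prop)
  refine (memLp_two_iff_integrable_sq_norm (hc.1.smul hf.1)).2 ?_
  refine (hsq.integrable_mul hc.integrable_sq (integrable_norm_sq hf)).congr
    (Eventually.of_forall fun ω => ?_)
  simp only [Pi.mul_apply, Pi.smul_apply', norm_smul, mul_pow, Real.norm_eq_abs, sq_abs]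

theorem integral_norm_add_smul_sq [SecondCountableTopology E] (hc : MemLp c 2 P)
    (hf : MemLp f 2 P) (hg : MemLp g 2 P) (hind : IndepFun c (fun ω => (f ω, g ω)) P) :
    ∫ ω, ‖f ω + c ω • g ω‖ ^ 2 ∂P =
      ∫ ω, ‖f ω‖ ^ 2 ∂P + 2 * ((∫ ω, c ω ∂P) * ∫ ω, inner ℝ (f ω) (g ω) ∂P) +
        (∫ ω, c ω ^ 2 ∂P) * ∫ ω, ‖g ω‖ ^ 2 ∂P := by
  have hg_ind : IndepFun c g P := hind.comp measurable_id measurable_snd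
  have hinner : IndepFun c (fun ω => inner ℝ (f ω) (g ω)) P :=
    hind.comp (ψ := fun p : E × E => (inner ℝ p.1 p.2 : ℝ)) measurable_id (by fun_prop)
  have hsq : IndepFun (fun ω => c ω ^ 2) (fun ω => ‖g ω‖ ^ 2) P :=
    hg_ind.comp (φ := fun x => x ^ 2) (ψ := fun x => ‖x‖ ^ 2) (by fun_prop) (by fun_prop)
  rw [integral_norm_add_sq hf (memLp_smul_of_indepFun hc hg hg_ind),
    ← hinner.integral_fun_mul_eq_mul_integral hc.1 (hf.1.inner hg.1),
    ← hsq.integral_fun_mul_eq_mul_integral (hc.1.pow 2) (hg.1.norm.pow 2)]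
  simp only [inner_smul_right, norm_smul, mul_pow, Real.norm_eq_abs, sq_abs]

end SecondMoments

section RandomWeights

variable {Ω ι E : Type*} [Fintype ι] {mΩ : MeasurableSpace Ω} {P : Measure Ω}
  [NormedAddCommGroup E] [NormedSpace ℝ E] {a : Ω → ι → ℝ}

theorem norm_sum_smul_sq_le {c : ι → ℝ} (hc : c ∈ stdSimplex ℝ ι) (x : ι → E) :
    ‖∑ i, c i • x i‖ ^ 2 ≤ ∑ i, c i * ‖x i‖ ^ 2 := by
  have hconvex : ConvexOn ℝ Set.univ fun x : E => ‖x‖ ^ 2 :=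
    convexOn_univ_norm.pow (fun x _ => norm_nonneg x) 2
  exact hconvex.map_sum_le (fun i _ => hc.1 i) hc.2 fun i _ => Set.mem_univ (x i)

theorem memLp_sum_smul_of_mem_stdSimplex {p : ENNReal}
    (ham : ∀ i, AEStronglyMeasurable (fun ω => a ω i) P) (ha : ∀ᵐ ω ∂P, a ω ∈ stdSimplex ℝ ι)
    {x : ι → Ω → E} (hx : ∀ i, MemLp (x i) p P) :
    MemLp (fun ω => ∑ i, a ω i • x i ω) p P :=
  memLp_finsetSum _ fun i _ => (hx i).of_le ((ham i).smul (hx i).1) <| by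
    filter_upwards [ha] with ω hω
    have hweight := mem_Icc_of_mem_stdSimplex hω i
    rw [norm_smul, Real.norm_of_nonneg hweight.1]
    exact mul_le_of_le_one_left (norm_nonneg _) hweight.2

variable [IsProbabilityMeasure P]

theorem integral_sum_mul_le_of_mem_stdSimplex
    (ham : ∀ i, AEStronglyMeasurable (fun ω => a ω i) P) (ha : ∀ᵐ ω ∂P, a ω ∈ stdSimplex ℝ ι)
    {y : ι → Ω → ℝ} (hy : ∀ i, Integrable (y i) P)
    (hind : ∀ i, IndepFun (fun ω => a ω i) (y i) P) {C : ℝ} (hC : ∀ i, ∫ ω, y i ω ∂P ≤ C) :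
    Integrable (fun ω => ∑ i, a ω i * y i ω) P ∧ ∫ ω, ∑ i, a ω i * y i ω ∂P ≤ C := by
  have hai : ∀ i, Integrable (fun ω => a ω i) P := fun i => by
    refine Integrable.of_bound (ham i) 1 ?_
    filter_upwards [ha] with ω hω
    have hweight := mem_Icc_of_mem_stdSimplex hω i
    rw [Real.norm_of_nonneg hweight.1]
    exact hweight.2
  have hayi : ∀ i, Integrable (fun ω => a ω i * y i ω) P := fun i =>
    (hind i).integrable_mul (hai i) (hy i)
  have hmean_nonneg : ∀ i, 0 ≤ ∫ ω, a ω i ∂P := fun i =>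
    integral_nonneg_of_ae (ha.mono fun ω hω => hω.1 i)
  have hmean_sum : ∑ i, ∫ ω, a ω i ∂P = 1 := by
    rw [← integral_finsetSum _ fun i _ => hai i, integral_congr_ae (ha.mono fun ω hω => hω.2),
      integral_const, probReal_univ, one_smul]
  refine ⟨integrable_finsetSum _ fun i _ => hayi i, ?_⟩
  calc ∫ ω, ∑ i, a ω i * y i ω ∂P
      = ∑ i, (∫ ω, a ω i ∂P) * ∫ ω, y i ω ∂P := by
        rw [integral_finsetSum _ fun i _ => hayi i]
        exact Finset.sum_congr rfl fun i _ =>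
          (hind i).integral_fun_mul_eq_mul_integral (ham i) (hy i).1
    _ ≤ ∑ i, (∫ ω, a ω i ∂P) * C :=
        Finset.sum_le_sum fun i _ => mul_le_mul_of_nonneg_left (hC i) (hmean_nonneg i)
    _ = C := by rw [← Finset.sum_mul, hmean_sum, one_mul]

end RandomWeights

section Recursion

theorem le_add_pow_mul_of_contraction {ι : Type*} {e : ℕ → ι → ℝ} {θ : ι → ℝ} {c ρ e₀ : ℝ}
    (hθ0 : ∀ k, 0 ≤ θ k) (hθρ : ∀ k, θ k ≤ ρ) (he₀ : 0 ≤ e₀)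
    (hinit : ∀ k, e 0 k ≤ c + e₀)
    (hstep : ∀ i C, (∀ ℓ, θ ℓ * e i ℓ + (1 - θ ℓ) * c ≤ C) → ∀ k, e (i + 1) k ≤ C)
    (i : ℕ) (k : ι) : e i k ≤ c + ρ ^ i * e₀ := by
  have hρ : 0 ≤ ρ := (hθ0 k).trans (hθρ k)
  induction i generalizing k with
  | zero => simpa only [pow_zero, one_mul] using hinit k
  | succ i ih =>
    refine hstep i _ (fun ℓ => ?_) k
    calc θ ℓ * e i ℓ + (1 - θ ℓ) * c
        ≤ θ ℓ * (c + ρ ^ i * e₀) + (1 - θ ℓ) * c :=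
          add_le_add_left (mul_le_mul_of_nonneg_left (ih ℓ) (hθ0 ℓ)) _
      _ = c + θ ℓ * (ρ ^ i * e₀) := by ring
      _ ≤ c + ρ * (ρ ^ i * e₀) := by gcongr; exact hθρ ℓ
      _ = c + ρ ^ (i + 1) * e₀ := by ring

theorem limsup_ofReal_le_of_le_add_pow_mul {u : ℕ → ℝ} {c ρ e₀ : ℝ} (hρ0 : 0 ≤ ρ) (hρ1 : ρ < 1)
    (hu : ∀ i, u i ≤ c + ρ ^ i * e₀) :
    limsup (fun i => ENNReal.ofReal (u i)) atTop ≤ ENNReal.ofReal c := by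
  have hlim : Tendsto (fun i : ℕ => c + ρ ^ i * e₀) atTop (nhds c) := by
    simpa only [zero_mul, add_zero] using
      ((tendsto_pow_atTop_nhds_zero_of_lt_one hρ0 hρ1).mul_const e₀).const_add c
  rw [← (ENNReal.tendsto_ofReal hlim).limsup_eq]
  exact limsup_le_limsup (Eventually.of_forall fun i => ENNReal.ofReal_le_ofReal (hu i))

end Recursion

namespace AsyncDiffusion

variable {N M : ℕ} {Ω X : Type*}

section Definitions

variable (net : AsyncDiffusion N M Ω X)

/-- The error `w̃` of agent `k` before the update of time `i`. -/
def error (wo : EuclideanSpace ℝ (Fin M)) (i : ℕ) (k : Fin N) (ω : Ω) :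
    EuclideanSpace ℝ (Fin M) :=
  wo - net.iter i ω k

/-- The error of agent `k` between the adaptation and the combination of time `i`. -/
def adaptError (wo : EuclideanSpace ℝ (Fin M)) (i : ℕ) (k : Fin N) (ω : Ω) :
    EuclideanSpace ℝ (Fin M) :=
  wo - net.adapt i ω (net.iter i ω) k

/-- The approximate gradient that agent `k` uses at time `i`. -/
def approxGrad (i : ℕ) (k : Fin N) (ω : Ω) : EuclideanSpace ℝ (Fin M) :=
  net.gradHat k (net.iter i ω k) (net.data i ω k)

/-- The true gradient of agent `k` at the iterate from which time `i` starts. -/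
noncomputable def trueGrad (J : Fin N → EuclideanSpace ℝ (Fin M) → ℝ) (i : ℕ) (k : Fin N) (ω : Ω) :
    EuclideanSpace ℝ (Fin M) :=
  gradient (J k) (net.iter i ω k)

end Definitions

/-- The gradient-noise model restricted to one agent at a time: as in `GradientNoiseConditions`,
but the noises of different agents may be correlated. -/
structure AgentwiseNoiseConditions [MeasurableSpace Ω] (net : AsyncDiffusion N M Ω X)
    (P : Measure Ω) (J : Fin N → EuclideanSpace ℝ (Fin M) → ℝ) (wo : EuclideanSpace ℝ (Fin M))
    (β σs : Fin N → ℝ) : Prop where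
  memLp : ∀ i k, MemLp (net.noise J i k) 2 P
  unbiased : ∀ i k, P[net.noise J i k | net.past i] =ᵐ[P] 0
  boundedVariance : ∀ i k, P[fun ω => ‖net.noise J i k ω‖ ^ 2 | net.past i] ≤ᵐ[P]
    fun ω => β k ^ 2 * ‖net.error wo i k ω‖ ^ 2 + σs k ^ 2

variable {net : AsyncDiffusion N M Ω X} {J : Fin N → EuclideanSpace ℝ (Fin M) → ℝ}
  {wo : EuclideanSpace ℝ (Fin M)} {β σs : Fin N → ℝ} {ν L : ℝ} {i : ℕ} {k : Fin N}

theorem GradientNoiseConditions.agentwise [MeasurableSpace Ω] {P : Measure Ω}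
    (hn : net.GradientNoiseConditions P J wo β σs) : net.AgentwiseNoiseConditions P J wo β σs :=
  ⟨hn.memLp, hn.unbiased, hn.boundedVariance⟩

theorem approxGrad_eq (ω : Ω) :
    net.approxGrad i k ω = net.trueGrad J i k ω + net.noise J i k ω :=
  (add_sub_cancel _ _).symm

theorem adaptError_eq (ω : Ω) :
    net.adaptError wo i k ω = net.error wo i k ω + net.step i ω k • net.approxGrad i k ω :=
  (sub_add ..).symm

theorem error_succ {ω : Ω} (hω : ∑ ℓ, net.comb i ω ℓ k = 1) :
    net.error wo (i + 1) k ω = ∑ ℓ, net.comb i ω ℓ k • net.adaptError wo i ℓ ω := by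
  simp only [error, adaptError, iter, smul_sub, Finset.sum_sub_distrib, ← Finset.sum_smul, hω,
    one_smul]

section Measurability

variable [MeasurableSpace X]

theorem measurable_adapt_of_measurable {m : MeasurableSpace Ω}
    (hgrad : ∀ k, Measurable (Function.uncurry (net.gradHat k)))
    (hstep : Measurable[m] (net.step i)) (hdata : Measurable[m] (net.data i))
    (hiter : Measurable[m] (net.iter i)) :
    Measurable[m] fun ω => net.adapt i ω (net.iter i ω) :=
  measurable_pi_lambda _ fun k =>
    have hpoint : Measurable[m] fun ω => net.iter i ω k := (measurable_pi_apply k).comp hiter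
    hpoint.sub (((measurable_pi_apply k).comp hstep).smul
      ((hgrad k).comp (hpoint.prodMk ((measurable_pi_apply k).comp hdata))))

theorem measurable_iter_of_measurable {m : MeasurableSpace Ω}
    (hgrad : ∀ k, Measurable (Function.uncurry (net.gradHat k)))
    (hinit : Measurable[m] net.init) (hdata : ∀ j, Measurable[m] (net.data j))
    (hstep : ∀ j < i, Measurable[m] (net.step j))
    (hcomb : ∀ j < i, ∀ ℓ k, Measurable[m] fun ω => net.comb j ω ℓ k) :
    Measurable[m] (net.iter i) := by
  induction i with
  | zero => exact hinit
  | succ i ih =>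
    have hadapt := measurable_adapt_of_measurable hgrad (hstep i i.lt_succ_self) (hdata i)
      (ih (fun j hj => hstep j (hj.trans i.lt_succ_self))
        fun j hj => hcomb j (hj.trans i.lt_succ_self))
    exact measurable_pi_lambda _ fun k => Finset.measurable_sum _ fun ℓ _ =>
      (hcomb i i.lt_succ_self ℓ k).smul ((measurable_pi_apply ℓ).comp hadapt)

end Measurability

theorem measurable_iter_past (i : ℕ) (k : Fin N) :
    Measurable[net.past i] fun ω => net.iter i ω k :=
  have hle : MeasurableSpace.comap (net.iter i) inferInstance ≤ net.past i :=
    le_iSup₂_of_le (f := fun j (_ : j ≤ i) => MeasurableSpace.comap (net.iter j) inferInstance)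
      i le_rfl le_rfl
  (measurable_pi_apply k).comp ((comap_measurable (net.iter i)).mono hle le_rfl)

theorem stronglyMeasurable_error_past (net : AsyncDiffusion N M Ω X)
    (wo : EuclideanSpace ℝ (Fin M)) (i : ℕ) (k : Fin N) :
    StronglyMeasurable[net.past i] (net.error wo i k) :=
  ((measurable_iter_past i k).const_sub wo).stronglyMeasurable

theorem stronglyMeasurable_trueGrad_past (net : AsyncDiffusion N M Ω X)
    (J : Fin N → EuclideanSpace ℝ (Fin M) → ℝ) (i : ℕ) (k : Fin N) :
    StronglyMeasurable[net.past i] (net.trueGrad J i k) :=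
  ((measurable_gradient (J k)).comp (measurable_iter_past i k)).stronglyMeasurable

variable [MeasurableSpace Ω] {P : Measure Ω}

theorem meanSquareError_eq_ofReal (hD : MemLp (net.error wo i k) 2 P) :
    net.meanSquareError P wo k i = ENNReal.ofReal (∫ ω, ‖net.error wo i k ω‖ ^ 2 ∂P) := by
  rw [ofReal_integral_eq_lintegral_ofReal (integrable_norm_sq hD)
    (Eventually.of_forall fun ω => sq_nonneg _), meanSquareError]
  refine lintegral_congr fun ω => ?_
  rw [ENNReal.ofReal_pow (norm_nonneg _), ofReal_norm, error]

theorem stepMean_add_div_le_muxMax (net : AsyncDiffusion N M Ω X) (P : Measure Ω) (k : Fin N) :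
    net.stepMean P k + net.stepVar P k / net.stepMean P k ≤ net.muxMax P :=
  le_ciSup (f := fun k => net.stepMean P k + net.stepVar P k / net.stepMean P k)
    (Set.finite_range _).bddAbove k

variable [MeasurableSpace X]

section Model

theorem Conditions.measurable_iter (h : net.Conditions P) (i : ℕ) : Measurable (net.iter i) :=
  measurable_iter_of_measurable h.measurable_gradHat h.measurable_init h.measurable_data
    (fun j _ => h.measurable_step j) fun j _ => h.measurable_comb j

theorem Conditions.past_le (h : net.Conditions P) (i : ℕ) : net.past i ≤ ‹MeasurableSpace Ω› :=
  iSup₂_le fun j _ => (h.measurable_iter j).comap_le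

theorem Conditions.comb_mem_stdSimplex (h : net.Conditions P) (i : ℕ) (k : Fin N) :
    ∀ᵐ ω ∂P, (fun ℓ => net.comb i ω ℓ k) ∈ stdSimplex ℝ (Fin N) :=
  (h.leftStochastic i).mono fun _ hω => ⟨fun ℓ => hω.1 ℓ k, hω.2 k⟩

theorem Conditions.stepMean_le_muxMax (h : net.Conditions P) (k : Fin N) :
    net.stepMean P k ≤ net.muxMax P :=
  (le_add_of_nonneg_right (div_nonneg (variance_nonneg _ _) (h.stepMean_pos k).le)).trans
    (net.stepMean_add_div_le_muxMax P k)

theorem Conditions.muxMax_pos (h : net.Conditions P) (k : Fin N) : 0 < net.muxMax P :=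
  (h.stepMean_pos k).trans_le (h.stepMean_le_muxMax k)

variable [IsProbabilityMeasure P]

theorem Conditions.integral_step_sq_le (h : net.Conditions P) (i : ℕ) (k : Fin N) :
    ∫ ω, net.step i ω k ^ 2 ∂P ≤ net.stepMean P k * net.muxMax P := by
  have hvar : net.stepVar P k = ∫ ω, net.step i ω k ^ 2 ∂P - net.stepMean P k ^ 2 := by
    rw [← h.var_step i k, variance_eq_sub (h.memLp_step i k), h.mean_step]
    rfl
  have hpos := h.stepMean_pos k
  calc ∫ ω, net.step i ω k ^ 2 ∂P
      = net.stepMean P k * (net.stepMean P k + net.stepVar P k / net.stepMean P k) := by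
        rw [hvar]
        field_simp
        ring
    _ ≤ net.stepMean P k * net.muxMax P :=
        mul_le_mul_of_nonneg_left (net.stepMean_add_div_le_muxMax P k) hpos.le

theorem Conditions.indepFun_step (h : net.Conditions P) (i : ℕ) :
    IndepFun (net.step i) (fun ω => (net.iter i ω, net.data i ω)) P := by
  have hcomb : Measurable fun ω (i : ℕ) (ℓ k : Fin N) => net.comb i ω ℓ k := by
    have := h.measurable_comb
    fun_prop
  have hgrad := h.measurable_gradHat
  refine indepFun_of_forall_measurable (S := Finset.range i) Finset.notMem_range_self
    h.measurable_step hcomb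
    (h.measurable_init.prodMk (measurable_pi_lambda _ h.measurable_data))
    h.indep_step h.indep_step_comb h.indep_other fun m hstep hcomb hother => ?_
  have hdata j : Measurable[m] (net.data j) := (measurable_pi_apply j).comp hother.snd
  refine Measurable.prodMk (measurable_iter_of_measurable hgrad hother.fst hdata
    (fun j hj => hstep j (Finset.mem_range.2 hj)) fun j _ ℓ k => ?_) (hdata i)
  exact (measurable_pi_apply k).comp ((measurable_pi_apply ℓ).comp
    ((measurable_pi_apply j).comp hcomb))

theorem Conditions.indepFun_comb (h : net.Conditions P) (i : ℕ) :
    IndepFun (fun ω ℓ k => net.comb i ω ℓ k) (fun ω => net.adapt i ω (net.iter i ω)) P := by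
  have hcomb i : Measurable fun ω (ℓ k : Fin N) => net.comb i ω ℓ k := by
    have := h.measurable_comb
    fun_prop
  have hgrad := h.measurable_gradHat
  refine indepFun_of_forall_measurable (S := Finset.range i) Finset.notMem_range_self hcomb
    (measurable_pi_lambda _ h.measurable_step)
    (h.measurable_init.prodMk (measurable_pi_lambda _ h.measurable_data))
    h.indep_comb h.indep_step_comb.symm (h.indep_other.comp measurable_swap measurable_id)
    fun m hcomb hstep hother => ?_
  have hdata j : Measurable[m] (net.data j) := (measurable_pi_apply j).comp hother.snd
  have hstep j : Measurable[m] (net.step j) := (measurable_pi_apply j).comp hstep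
  refine measurable_adapt_of_measurable hgrad (hstep i) (hdata i)
    (measurable_iter_of_measurable hgrad hother.fst hdata (fun j _ => hstep j)
      fun j hj ℓ k => ?_)
  exact (measurable_pi_apply k).comp ((measurable_pi_apply ℓ).comp
    (hcomb j (Finset.mem_range.2 hj)))

theorem Conditions.indepFun_step_error_approxGrad (h : net.Conditions P)
    (wo : EuclideanSpace ℝ (Fin M)) (i : ℕ) (k : Fin N) :
    IndepFun (fun ω => net.step i ω k)
      (fun ω => (net.error wo i k ω, net.approxGrad i k ω)) P := by
  have hgrad := h.measurable_gradHat k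
  exact (h.indepFun_step i).comp (φ := fun f : Fin N → ℝ => f k)
    (ψ := fun p : (Fin N → EuclideanSpace ℝ (Fin M)) × (Fin N → X) =>
      (wo - p.1 k, Function.uncurry (net.gradHat k) (p.1 k, p.2 k))) (by fun_prop) (by fun_prop)

theorem Conditions.indepFun_comb_norm_adaptError_sq (h : net.Conditions P)
    (wo : EuclideanSpace ℝ (Fin M)) (i : ℕ) (k ℓ : Fin N) :
    IndepFun (fun ω => net.comb i ω ℓ k) (fun ω => ‖net.adaptError wo i ℓ ω‖ ^ 2) P :=
  (h.indepFun_comb i).comp (φ := fun f : Fin N → Fin N → ℝ => f ℓ k)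
    (ψ := fun f : Fin N → EuclideanSpace ℝ (Fin M) => ‖wo - f ℓ‖ ^ 2) (by fun_prop) (by fun_prop)

end Model

section Integrability

theorem Conditions.memLp_trueGrad (h : net.Conditions P)
    (hJ : FirstOrderCostConditions J wo ν L) (hD : MemLp (net.error wo i k) 2 P) :
    MemLp (net.trueGrad J i k) 2 P :=
  hD.of_le_mul
    ((net.stronglyMeasurable_trueGrad_past J i k).mono (h.past_le i)).aestronglyMeasurable
    (Eventually.of_forall fun ω => hJ.growth k (net.iter i ω k))

theorem Conditions.memLp_approxGrad (h : net.Conditions P)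
    (hJ : FirstOrderCostConditions J wo ν L) (hn : net.AgentwiseNoiseConditions P J wo β σs)
    (hD : MemLp (net.error wo i k) 2 P) : MemLp (net.approxGrad i k) 2 P :=
  funext (approxGrad_eq (net := net) (J := J)) ▸ (h.memLp_trueGrad hJ hD).add (hn.memLp i k)

theorem Conditions.memLp_error_succ (h : net.Conditions P)
    (hA : ∀ ℓ, MemLp (net.adaptError wo i ℓ) 2 P) (k : Fin N) :
    MemLp (net.error wo (i + 1) k) 2 P :=
  (memLp_sum_smul_of_mem_stdSimplex (fun ℓ => (h.measurable_comb i ℓ k).aestronglyMeasurable)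
    (h.comb_mem_stdSimplex i k) hA).ae_eq
    ((h.comb_mem_stdSimplex i k).mono fun _ hω => (error_succ hω.2).symm)

variable [IsProbabilityMeasure P]

theorem Conditions.memLp_adaptError (h : net.Conditions P)
    (hJ : FirstOrderCostConditions J wo ν L) (hn : net.AgentwiseNoiseConditions P J wo β σs)
    (hD : MemLp (net.error wo i k) 2 P) : MemLp (net.adaptError wo i k) 2 P := by
  simp only [funext adaptError_eq]
  exact hD.add (memLp_smul_of_indepFun (h.memLp_step i k) (h.memLp_approxGrad hJ hn hD)
    ((h.indepFun_step_error_approxGrad wo i k).comp measurable_id measurable_snd))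

theorem Conditions.memLp_error (h : net.Conditions P)
    (hJ : FirstOrderCostConditions J wo ν L) (hn : net.AgentwiseNoiseConditions P J wo β σs)
    (i : ℕ) (k : Fin N) : MemLp (net.error wo i k) 2 P := by
  induction i generalizing k with
  | zero => exact (memLp_const wo).sub (h.memLp_init k)
  | succ i ih => exact h.memLp_error_succ (fun ℓ => h.memLp_adaptError hJ hn (ih ℓ)) k

end Integrability

section MeanSquare

variable [IsProbabilityMeasure P]

theorem Conditions.integral_norm_noise_sq_le (h : net.Conditions P)
    (hn : net.AgentwiseNoiseConditions P J wo β σs) (hD : MemLp (net.error wo i k) 2 P) :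
    ∫ ω, ‖net.noise J i k ω‖ ^ 2 ∂P ≤ β k ^ 2 * ∫ ω, ‖net.error wo i k ω‖ ^ 2 ∂P + σs k ^ 2 := by
  have hscaled := (integrable_norm_sq hD).const_mul (β k ^ 2)
  calc ∫ ω, ‖net.noise J i k ω‖ ^ 2 ∂P
      = ∫ ω, (P[fun ω => ‖net.noise J i k ω‖ ^ 2 | net.past i]) ω ∂P :=
        (integral_condExp (h.past_le i)).symm
    _ ≤ ∫ ω, (β k ^ 2 * ‖net.error wo i k ω‖ ^ 2 + σs k ^ 2) ∂P :=
        integral_mono_ae integrable_condExp (hscaled.add (integrable_const _))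
          (hn.boundedVariance i k)
    _ = β k ^ 2 * ∫ ω, ‖net.error wo i k ω‖ ^ 2 ∂P + σs k ^ 2 := by
        rw [integral_add hscaled (integrable_const _), integral_const_mul, integral_const,
          probReal_univ, one_smul]

theorem Conditions.integral_norm_approxGrad_sq_le (h : net.Conditions P)
    (hJ : FirstOrderCostConditions J wo ν L) (hn : net.AgentwiseNoiseConditions P J wo β σs)
    (hD : MemLp (net.error wo i k) 2 P) :
    ∫ ω, ‖net.approxGrad i k ω‖ ^ 2 ∂P ≤
      (L ^ 2 + β k ^ 2) * ∫ ω, ‖net.error wo i k ω‖ ^ 2 ∂P + σs k ^ 2 := by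
  have hG := h.memLp_trueGrad hJ hD
  have hcross : ∫ ω, inner ℝ (net.trueGrad J i k ω) (net.noise J i k ω) ∂P = 0 :=
    integral_inner_eq_zero_of_condExp_eq_zero (h.past_le i)
      (net.stronglyMeasurable_trueGrad_past J i k) hG (hn.memLp i k) (hn.unbiased i k)
  have htrue : ∫ ω, ‖net.trueGrad J i k ω‖ ^ 2 ∂P ≤
      L ^ 2 * ∫ ω, ‖net.error wo i k ω‖ ^ 2 ∂P := by
    rw [← integral_const_mul]
    refine integral_mono (integrable_norm_sq hG) ((integrable_norm_sq hD).const_mul _) fun ω => ?_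
    rw [← mul_pow]
    exact pow_le_pow_left₀ (norm_nonneg _) (hJ.growth k (net.iter i ω k)) 2
  simp only [approxGrad_eq (J := J)]
  rw [integral_norm_add_sq hG (hn.memLp i k), hcross]
  linarith [h.integral_norm_noise_sq_le hn hD]

theorem Conditions.integral_inner_error_approxGrad_le (h : net.Conditions P)
    (hJ : FirstOrderCostConditions J wo ν L) (hn : net.AgentwiseNoiseConditions P J wo β σs)
    (hD : MemLp (net.error wo i k) 2 P) :
    ∫ ω, inner ℝ (net.error wo i k ω) (net.approxGrad i k ω) ∂P ≤
      -(ν * ∫ ω, ‖net.error wo i k ω‖ ^ 2 ∂P) := by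
  have hG := h.memLp_trueGrad hJ hD
  have hcross : ∫ ω, inner ℝ (net.error wo i k ω) (net.noise J i k ω) ∂P = 0 :=
    integral_inner_eq_zero_of_condExp_eq_zero (h.past_le i)
      (net.stronglyMeasurable_error_past wo i k) hD (hn.memLp i k) (hn.unbiased i k)
  calc ∫ ω, inner ℝ (net.error wo i k ω) (net.approxGrad i k ω) ∂P
      = ∫ ω, inner ℝ (net.error wo i k ω) (net.trueGrad J i k ω) ∂P := by
        simp only [approxGrad_eq (J := J), inner_add_right]
        rw [integral_add (integrable_inner hD hG) (integrable_inner hD (hn.memLp i k)), hcross,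
          add_zero]
    _ ≤ ∫ ω, -(ν * ‖net.error wo i k ω‖ ^ 2) ∂P :=
        integral_mono (integrable_inner hD hG) ((integrable_norm_sq hD).const_mul ν).neg
          fun ω => le_neg_of_le_neg (hJ.secant k (net.iter i ω k))
    _ = -(ν * ∫ ω, ‖net.error wo i k ω‖ ^ 2 ∂P) := by rw [integral_neg, integral_const_mul]

theorem Conditions.integral_norm_adaptError_sq_le (h : net.Conditions P)
    (hJ : FirstOrderCostConditions J wo ν L) (hn : net.AgentwiseNoiseConditions P J wo β σs)
    (hμ : net.muxMax P * (L ^ 2 + β k ^ 2) ≤ ν) (hD : MemLp (net.error wo i k) 2 P) :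
    ∫ ω, ‖net.adaptError wo i k ω‖ ^ 2 ∂P ≤
      (1 - ν * net.stepMean P k) * ∫ ω, ‖net.error wo i k ω‖ ^ 2 ∂P +
        net.stepMean P k * (net.muxMax P * σs k ^ 2) := by
  have hH := h.memLp_approxGrad hJ hn hD
  have hmean := (h.stepMean_pos k).le
  have hmux := (h.muxMax_pos k).le
  set D2 := ∫ ω, ‖net.error wo i k ω‖ ^ 2 ∂P
  have : 0 ≤ D2 := integral_nonneg fun ω => sq_nonneg _
  calc ∫ ω, ‖net.adaptError wo i k ω‖ ^ 2 ∂P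
      = D2 + 2 * (net.stepMean P k *
            ∫ ω, inner ℝ (net.error wo i k ω) (net.approxGrad i k ω) ∂P) +
          (∫ ω, net.step i ω k ^ 2 ∂P) * ∫ ω, ‖net.approxGrad i k ω‖ ^ 2 ∂P := by
        simp only [adaptError_eq]
        rw [integral_norm_add_smul_sq (h.memLp_step i k) hD hH
          (h.indepFun_step_error_approxGrad wo i k), h.mean_step]
    _ ≤ D2 + 2 * (net.stepMean P k * -(ν * D2)) +
          net.stepMean P k * net.muxMax P * ((L ^ 2 + β k ^ 2) * D2 + σs k ^ 2) := by
        gcongr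
        · exact h.integral_inner_error_approxGrad_le hJ hn hD
        · exact h.integral_step_sq_le i k
        · exact h.integral_norm_approxGrad_sq_le hJ hn hD
    _ = (1 - 2 * (ν * net.stepMean P k)) * D2 +
          net.stepMean P k * (net.muxMax P * (L ^ 2 + β k ^ 2)) * D2 +
            net.stepMean P k * (net.muxMax P * σs k ^ 2) := by ring
    _ ≤ (1 - 2 * (ν * net.stepMean P k)) * D2 + net.stepMean P k * ν * D2 +
            net.stepMean P k * (net.muxMax P * σs k ^ 2) := by gcongr
    _ = (1 - ν * net.stepMean P k) * D2 + net.stepMean P k * (net.muxMax P * σs k ^ 2) := by ring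

theorem Conditions.integral_norm_error_succ_sq_le (h : net.Conditions P)
    (hA : ∀ ℓ, MemLp (net.adaptError wo i ℓ) 2 P) {C : ℝ}
    (hC : ∀ ℓ, ∫ ω, ‖net.adaptError wo i ℓ ω‖ ^ 2 ∂P ≤ C) (k : Fin N) :
    ∫ ω, ‖net.error wo (i + 1) k ω‖ ^ 2 ∂P ≤ C := by
  obtain ⟨hint, hle⟩ := integral_sum_mul_le_of_mem_stdSimplex
    (fun ℓ => (h.measurable_comb i ℓ k).aestronglyMeasurable) (h.comb_mem_stdSimplex i k)
    (fun ℓ => integrable_norm_sq (hA ℓ)) (h.indepFun_comb_norm_adaptError_sq wo i k) hC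
  refine (integral_mono_ae (integrable_norm_sq (h.memLp_error_succ hA k)) hint ?_).trans hle
  filter_upwards [h.comb_mem_stdSimplex i k] with ω hω
  rw [error_succ hω.2]
  exact norm_sum_smul_sq_le hω _

theorem Conditions.integral_norm_error_sq_le (h : net.Conditions P)
    (hJ : FirstOrderCostConditions J wo ν L) (hn : net.AgentwiseNoiseConditions P J wo β σs)
    {S ρ : ℝ} (hσ : ∀ k, σs k ^ 2 ≤ S)
    (hμ : ∀ k, net.muxMax P * (L ^ 2 + β k ^ 2) ≤ ν) (hρ0 : ∀ k, 0 ≤ 1 - ν * net.stepMean P k)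
    (hρ : ∀ k, 1 - ν * net.stepMean P k ≤ ρ) (i : ℕ) (k : Fin N) :
    ∫ ω, ‖net.error wo i k ω‖ ^ 2 ∂P ≤
      S / ν * net.muxMax P + ρ ^ i * ∑ ℓ, ∫ ω, ‖net.error wo 0 ℓ ω‖ ^ 2 ∂P := by
  have hν := hJ.pos
  have hS : 0 ≤ S := (sq_nonneg _).trans (hσ k)
  have hinit : ∀ ℓ, 0 ≤ ∫ ω, ‖net.error wo 0 ℓ ω‖ ^ 2 ∂P := fun ℓ =>
    integral_nonneg fun ω => sq_nonneg _
  refine le_add_pow_mul_of_contraction (e := fun i k => ∫ ω, ‖net.error wo i k ω‖ ^ 2 ∂P)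
    hρ0 hρ (Finset.sum_nonneg fun ℓ _ => hinit ℓ) (fun ℓ => ?_)
    (fun i C hC ℓ => ?_) i k
  · exact (Finset.single_le_sum (fun ℓ _ => hinit ℓ) (Finset.mem_univ ℓ)).trans
      (le_add_of_nonneg_left (mul_nonneg (div_nonneg hS hν.le) (h.muxMax_pos k).le))
  · have hD := h.memLp_error hJ hn i
    refine h.integral_norm_error_succ_sq_le (fun j => h.memLp_adaptError hJ hn (hD j))
      (fun j => (h.integral_norm_adaptError_sq_le hJ hn (hμ j) (hD j)).trans
        (le_trans ?_ (hC j))) ℓ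
    have hmean := (h.stepMean_pos j).le
    have hmux := (h.muxMax_pos j).le
    have hfixed : net.stepMean P j * (net.muxMax P * S) =
        (1 - (1 - ν * net.stepMean P j)) * (S / ν * net.muxMax P) := by
      field_simp
      ring
    rw [← hfixed]
    gcongr
    exact hσ j

theorem Conditions.limsup_meanSquareError_le (h : net.Conditions P)
    (hJ : FirstOrderCostConditions J wo ν L) (hn : net.AgentwiseNoiseConditions P J wo β σs)
    {S : ℝ} (hσ : ∀ k, σs k ^ 2 ≤ S)
    (hμ : ∀ k, net.muxMax P * (ν ^ 2 + L ^ 2 + β k ^ 2) ≤ ν) (k : Fin N) :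
    limsup (net.meanSquareError P wo k) atTop ≤ ENNReal.ofReal (S / ν * net.muxMax P) := by
  have hν := hJ.pos
  have hmux := h.muxMax_pos k
  have hμ_noise : ∀ ℓ, net.muxMax P * (L ^ 2 + β ℓ ^ 2) ≤ ν := fun ℓ =>
    (mul_le_mul_of_nonneg_left (by linarith [sq_nonneg ν]) hmux.le).trans (hμ ℓ)
  have hμ_convex : ν * net.muxMax P ≤ 1 := by
    refine le_of_mul_le_mul_left ?_ hν
    calc ν * (ν * net.muxMax P)
        = net.muxMax P * ν ^ 2 := by ring
      _ ≤ net.muxMax P * (ν ^ 2 + L ^ 2 + β k ^ 2) :=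
          mul_le_mul_of_nonneg_left (by linarith [sq_nonneg L, sq_nonneg (β k)]) hmux.le
      _ ≤ ν * 1 := (hμ k).trans_eq (mul_one ν).symm
  have hρ0 : ∀ ℓ, 0 ≤ 1 - ν * net.stepMean P ℓ := fun ℓ => sub_nonneg.2
    ((mul_le_mul_of_nonneg_left (h.stepMean_le_muxMax ℓ) hν.le).trans hμ_convex)
  have : Nonempty (Fin N) := ⟨k⟩
  obtain ⟨k₀, hk₀⟩ := Finite.exists_min (net.stepMean P)
  simp only [funext fun i => meanSquareError_eq_ofReal (h.memLp_error hJ hn i k)]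
  exact limsup_ofReal_le_of_le_add_pow_mul (hρ0 k₀)
    (sub_lt_self 1 (mul_pos hν (h.stepMean_pos k₀))) fun i =>
      h.integral_norm_error_sq_le hJ hn hσ hμ_noise hρ0
        (fun ℓ => sub_le_sub_left (mul_le_mul_of_nonneg_left (hk₀ ℓ) hν.le) 1) i k

end MeanSquare

end AsyncDiffusion

theorem lemma4_general {N M : ℕ} {J : Fin N → EuclideanSpace ℝ (Fin M) → ℝ}
    {wo : EuclideanSpace ℝ (Fin M)} {ν L : ℝ} (hJ : FirstOrderCostConditions J wo ν L)
    (β σs : Fin N → ℝ) :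
    ∃ μo : ℝ, 0 < μo ∧ ∃ b : ℝ, 0 ≤ b ∧
      ∀ (Ω : Type*) [MeasurableSpace Ω] (P : Measure Ω) [IsProbabilityMeasure P]
        (X : Type*) [MeasurableSpace X] (net : AsyncDiffusion N M Ω X),
        net.Conditions P → net.AgentwiseNoiseConditions P J wo β σs →
        net.muxMax P < μo →
        ∀ k, limsup (net.meanSquareError P wo k) atTop ≤ ENNReal.ofReal (b * net.muxMax P) := by
  have hν := hJ.pos
  refine ⟨ν / (ν ^ 2 + L ^ 2 + ∑ k, β k ^ 2), by positivity, (∑ k, σs k ^ 2) / ν, by positivity,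
    fun Ω _ P _ X _ net h hn hμ k => h.limsup_meanSquareError_le hJ hn
      (fun ℓ => Finset.single_le_sum (fun j _ => sq_nonneg (σs j)) (Finset.mem_univ ℓ))
      (fun ℓ => ?_) k⟩
  rw [lt_div_iff₀ (by positivity)] at hμ
  refine (mul_le_mul_of_nonneg_left ?_ (h.muxMax_pos k).le).trans hμ.le
  gcongr
  exact Finset.single_le_sum (fun j _ => sq_nonneg (β j)) (Finset.mem_univ ℓ)

theorem lemma4 {N M : ℕ} (J : Fin N → EuclideanSpace ℝ (Fin M) → ℝ)
    (wo : EuclideanSpace ℝ (Fin M)) (hJ : CostConditions J wo) (β σs : Fin N → ℝ) :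
    ∃ μo : ℝ, 0 < μo ∧ ∃ b : ℝ, 0 ≤ b ∧
      ∀ (Ω : Type*) [MeasurableSpace Ω] (P : Measure Ω) [IsProbabilityMeasure P]
        (X : Type*) [MeasurableSpace X] (net : AsyncDiffusion N M Ω X),
        net.Conditions P → net.GradientNoiseConditions P J wo β σs →
        net.muxMax P < μo →
        ∀ k, limsup (net.meanSquareError P wo k) atTop ≤ ENNReal.ofReal (b * net.muxMax P) := by
  obtain ⟨ν, L, hfirst⟩ := hJ.exists_firstOrderCostConditions
  obtain ⟨μo, hμo, b, hb, hbound⟩ := lemma4_general hfirst β σs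
  exact ⟨μo, hμo, b, hb, fun Ω _ P _ X _ net h hn => hbound Ω P X net h hn.agentwise⟩
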